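/- For $x\subseteq\omega$ put $x^1=x$ and $x^0=\omega\setminus x$. A collection $\mathcal{A}$ of subsets of $\omega$ is an independent family if $\bigcap_{x\in F}x^{\nu(x)}$ is infinite for every non-empty finite $F\subseteq\mathcal{A}$ and every $\nu:F\to\{0,1\}$. Subsets of $\omega$ are identified with their characteristic functions, so that a collection of subsets of $\omega$ is a subset of the Cantor space $2^\omega$ (the product of countably many copies of the discrete space $\{0,1\}$). Theorem. (ZFC) There exists an independent family $\mathcal{A}$ that is non-meager, that is, $\mathcal{A}$ is not a countable union of nowhere dense subsets of $2^\omega$. -/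

import Mathlib

/-- For `x ⊆ I`, the set `x ^ 1 = x` (`true`) and the set `x ^ 0 = I \ x` (`false`). -/
def signedSet {I : Type*} (x : Set I) (ε : Bool) : Set I :=
  if ε = true then x else xᶜ

/-- A collection `A` of subsets of `I` is an independent family if, for every non-empty finite
`F ⊆ A` and every `ν : F → 2`, the set `⋂ x ∈ F, x ^ ν(x)` is infinite. -/
def IsIndependentFamily {I : Type*} (A : Set (Set I)) : Prop :=
  ∀ F : Finset (Set I), F.Nonempty → (F : Set (Set I)) ⊆ A →
    ∀ ν : F → Bool, (⋂ x : F, signedSet (x : Set I) (ν x)).Infinite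

/-- The set of the characteristic functions of the members of `A`, as a subset of `2 ^ I`
(the function space `I → Bool` has the product topology, with `Bool` discrete). -/
def charFunctions {I : Type*} (A : Set (Set I)) : Set (I → Bool) :=
  {f | {i | f i = true} ∈ A}

/-- A collection of subsets of `I` is meager if it is meager as a subset of `2 ^ I`. -/
def IsMeagerCollection {I : Type*} (A : Set (Set I)) : Prop :=
  IsMeagre (charFunctions A)

open Filter Topology

/-! Split `ℕ` into finite levels on which the sets `c t` are independent, and let the set with index
`t` follow `c t` except on the levels, outside a set of a nonprincipal ultrafilter, where it copies
a free sequence coded in `t`. Finitely many such sets are undisturbed on infinitely many common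
levels, so they are independent. A comeager set contains all finite modifications of some `z`, so
copying `z` on suitable intervals of levels forces membership; an ultrafilter omits a set containing
enough such intervals. -/

/-- Negation of the coordinates in a finite set, as a homeomorphism of the Cantor space. -/
def flipHomeomorph (σ : Finset ℕ) : (ℕ → Bool) ≃ₜ (ℕ → Bool) where
  toFun z i := xor (z i) (decide (i ∈ σ))
  invFun z i := xor (z i) (decide (i ∈ σ))
  left_inv z := by ext i; simp
  right_inv z := by ext i; simp
  continuous_toFun := continuous_pi fun i =>
    (continuous_of_discreteTopology (f := fun b : Bool => xor b (decide (i ∈ σ)))).comp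
      (continuous_apply i)
  continuous_invFun := continuous_pi fun i =>
    (continuous_of_discreteTopology (f := fun b : Bool => xor b (decide (i ∈ σ)))).comp
      (continuous_apply i)

/-- A comeager subset of the Cantor space contains all finite modifications of some point. -/
theorem exists_finite_modifications_mem {G : Set (ℕ → Bool)} (hG : G ∈ residual (ℕ → Bool)) :
    ∃ z : ℕ → Bool, ∀ g : ℕ → Bool, {i | g i ≠ z i}.Finite → g ∈ G := by
  have h : ∀ᶠ z in residual (ℕ → Bool), ∀ σ : Finset ℕ, flipHomeomorph σ z ∈ G :=
    eventually_countable_forall.2 fun σ =>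
      tendsto_residual_of_isOpenMap (flipHomeomorph σ).continuous
        (flipHomeomorph σ).isOpenMap hG
  obtain ⟨z, hz⟩ := (dense_of_mem_residual h).nonempty
  refine ⟨z, fun g hg => ?_⟩
  convert hz hg.toFinset using 1
  ext i
  cases hgi : g i <;> cases hzi : z i <;> simp [flipHomeomorph, hgi, hzi]

/-- A neighbourhood in the Cantor space contains a basic clopen set. -/
theorem exists_finset_of_mem_nhds {V : Set (ℕ → Bool)} {g : ℕ → Bool} (hV : V ∈ 𝓝 g) :
    ∃ Q : Finset ℕ, ∀ f : ℕ → Bool, (∀ i ∈ Q, f i = g i) → f ∈ V := by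
  rw [nhds_pi, Filter.mem_pi'] at hV
  obtain ⟨Q, t, ht, hs⟩ := hV
  refine ⟨Q, fun f hf => hs fun i hi => ?_⟩
  rw [hf i hi]
  exact mem_of_mem_nhds (ht i)

/-- If all finite modifications of `z` lie in the open set `V`, then so do all points that agree
with `z` on a suitable finite set disjoint from a given finite set. -/
theorem exists_finset_agree_mem {V : Set (ℕ → Bool)} (hV : IsOpen V) {z : ℕ → Bool}
    (hz : ∀ g : ℕ → Bool, {i | g i ≠ z i}.Finite → g ∈ V) (P : Finset ℕ) :
    ∃ Q : Finset ℕ, ∀ f : ℕ → Bool, (∀ i ∈ Q, i ∉ P → f i = z i) → f ∈ V := by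
  have hmod : ∀ τ : Finset ℕ, ∃ Q : Finset ℕ, ∀ f : ℕ → Bool,
      (∀ i ∈ Q, f i = flipHomeomorph τ z i) → f ∈ V := fun τ => by
    refine exists_finset_of_mem_nhds (hV.mem_nhds (hz _ (τ.finite_toSet.subset fun i hi => ?_)))
    by_contra h
    exact hi (by simp_all [flipHomeomorph])
  choose Q hQ using hmod
  -- Only the finitely many modifications of `z` inside `P` matter.
  refine ⟨P.powerset.biUnion Q, fun f hf => ?_⟩
  refine hQ (P.filter fun i => f i ≠ z i) f fun i hi => ?_
  by_cases hP : i ∈ P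
  · cases hfi : f i <;> cases hzi : z i <;> simp [flipHomeomorph, hP, hfi, hzi]
  · have := hf i (Finset.mem_biUnion.2 ⟨_, by simp, hi⟩) hP
    simp [flipHomeomorph, hP, this]

/-- A rank function with finite fibres, and sets indexed by the branches of a finitely branching
tree whose Boolean combinations meet all but finitely many fibres. -/
theorem exists_rank_independent (α : Type) [Finite α] :
    ∃ (r : ℕ → ℕ) (c : (ℕ → α) → Set ℕ), (∀ n, {i | r i ≤ n}.Finite) ∧
      ∀ (F : Set (ℕ → α)) (ν : (ℕ → α) → Bool), F.Finite →
        ∀ᶠ n in atTop, ∃ i, r i = n ∧ ∀ t ∈ F, (i ∈ c t ↔ ν t = true) := by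
  -- Level `k` has one point for each set of nodes of height `k`, so every pattern on separated
  -- branches is realized there.
  let J := Σ k : ℕ, Set (Fin k → α)
  have : Infinite J := Infinite.of_injective (fun k : ℕ => (⟨k, ∅⟩ : J)) fun a b h =>
    congrArg Sigma.fst h
  obtain ⟨_⟩ := nonempty_denumerable J
  let e : ℕ ≃ J := (Denumerable.eqv J).symm
  refine ⟨fun i => (e i).1, fun t => {i | (fun j : Fin (e i).1 => t j) ∈ (e i).2}, fun n => ?_,
    fun F ν hF => ?_⟩
  · have hfin : (Set.range fun p : Σ k : Fin (n + 1), Set (Fin k → α) =>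
        (⟨p.1, p.2⟩ : J)).Finite := Set.finite_range _
    refine (hfin.preimage e.injective.injOn).subset fun i hi => ?_
    exact ⟨⟨⟨(e i).1, Nat.lt_succ_of_le hi⟩, (e i).2⟩, rfl⟩
  · have hsep : ∀ᶠ n in atTop, ∀ s ∈ F, ∀ t ∈ F, (∀ j < n, s j = t j) → s = t := by
      refine (eventually_all_finite hF).2 fun s _ => (eventually_all_finite hF).2 fun t _ => ?_
      by_cases h : s = t
      · simp [h]
      · obtain ⟨j, hj⟩ := Function.ne_iff.1 h
        filter_upwards [eventually_gt_atTop j] with n hn hst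
        exact absurd (hst j hn) hj
    filter_upwards [hsep] with n hn
    let S : Set (Fin n → α) := {u | ∃ s ∈ F, ν s = true ∧ (fun j : Fin n => s j) = u}
    have key : ∀ p : J, p = ⟨n, S⟩ → p.1 = n ∧ ∀ t ∈ F,
        ((fun j : Fin p.1 => t j) ∈ p.2 ↔ ν t = true) := by
      rintro _ rfl
      refine ⟨rfl, fun t ht => ⟨?_, fun h => ⟨t, ht, h, rfl⟩⟩⟩
      rintro ⟨s, hs, hν, hst⟩
      rwa [← hn s hs t ht fun j hj => congrFun hst ⟨j, hj⟩]
    exact ⟨e.symm ⟨n, S⟩, key _ (e.apply_symm_apply _)⟩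

/-- Given countably many monotone requirements on intervals of natural numbers, each of which
can be met beyond any bound, an ultrafilter omits a set containing intervals that meet all. -/
theorem exists_not_mem_ultrafilter (U : Ultrafilter ℕ) (p : ℕ → ℕ → ℕ → Prop)
    (hmono : ∀ k a b b', b ≤ b' → p k a b → p k a b') (hp : ∀ k a, ∃ b, p k a b) :
    ∃ B : Set ℕ, Bᶜ ∈ U ∧ ∀ k, ∃ a b, p k a b ∧ Set.Ico a b ⊆ B := by
  choose h hh using hp
  let s : ℕ → ℕ := fun j => Nat.rec 0 (fun j a => a + (Finset.range (j + 1)).sup fun k => h k a) j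
  have hs : ∀ j, s (j + 1) = s j + (Finset.range (j + 1)).sup fun k => h k (s j) := fun _ => rfl
  have smono : Monotone s := monotone_nat_of_le_succ fun j => by rw [hs]; omega
  have hps : ∀ k j, k ≤ j → p k (s j) (s (j + 1)) := fun k j hkj => by
    refine hmono _ _ _ _ ?_ (hh k (s j))
    rw [hs]
    exact (Finset.le_sup (f := fun k => h k (s j))
      (Finset.mem_range.2 (Nat.lt_succ_of_le hkj))).trans (Nat.le_add_left _ _)
  -- Block `j` meets requirements `0, …, j`, so the even blocks and the odd blocks each meet all of
  -- them, and one of `E`, `Eᶜ` is omitted by `U`.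
  let E : Set ℕ := {n | ∃ j, s (2 * j) ≤ n ∧ n < s (2 * j + 1)}
  rcases U.mem_or_compl_mem E with hE | hE
  · refine ⟨Eᶜ, by simpa using hE, fun k => ⟨_, _, hps k (2 * k + 1) (by omega), ?_⟩⟩
    rintro n ⟨h1, h2⟩ ⟨j, h3, h4⟩
    rcases le_or_gt j k with hjk | hjk
    · have := smono (show 2 * j + 1 ≤ 2 * k + 1 by omega)
      omega
    · have := smono (show 2 * k + 1 + 1 ≤ 2 * j by omega)
      omega
  · exact ⟨E, hE, fun k => ⟨_, _, hps k (2 * k) (by omega), fun n hn => ⟨k, hn.1, hn.2⟩⟩⟩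

open Classical in
/-- The set with index `t`: it follows the first coordinate of `t` on the levels selected by the
second coordinate, and follows `c t` on the other levels. -/
def mixedSet (r : ℕ → ℕ) (c : (ℕ → Bool × Bool) → Set ℕ) (t : ℕ → Bool × Bool) : Set ℕ :=
  {i | if (t (r i)).2 = true then (t i).1 = true else i ∈ c t}

theorem isIndependentFamily_mixedSet {U : Ultrafilter ℕ} (hU : (U : Filter ℕ) ≤ atTop)
    {r : ℕ → ℕ} {c : (ℕ → Bool × Bool) → Set ℕ}
    (hc : ∀ (F : Set (ℕ → Bool × Bool)) (ν : (ℕ → Bool × Bool) → Bool), F.Finite →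
      ∀ᶠ n in atTop, ∃ i, r i = n ∧ ∀ t ∈ F, (i ∈ c t ↔ ν t = true)) :
    IsIndependentFamily (mixedSet r c '' {t | ∀ᶠ n in U, (t n).2 = false}) := by
  classical
  intro F _ hFA ν
  choose t ht hteq using fun x : F => hFA x.2
  have hcn := hc (Set.range t) (fun u => if h : ∃ x, t x = u then ν h.choose else false)
    (Set.finite_range t)
  have hsmall : ∀ᶠ n in U, ∀ x, (t x n).2 = false := eventually_all.2 ht
  have hfreq : ∃ᶠ n in atTop, ∃ i ∈ ⋂ x : F, signedSet (x : Set ℕ) (ν x), r i = n := by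
    refine Frequently.filter_mono (Eventually.frequently ?_) hU
    filter_upwards [hsmall, hU hcn] with n hn ⟨i, hi, hit⟩
    refine ⟨i, Set.mem_iInter.2 fun x => ?_, hi⟩
    have hx := hit (t x) ⟨x, rfl⟩
    have hex : ∃ y, t y = t x := ⟨x, rfl⟩
    -- An index determines its set, so distinct members have distinct indices.
    have hch : hex.choose = x := by
      apply Subtype.ext
      rw [← hteq, ← hteq, hex.choose_spec]
    rw [dif_pos hex, hch] at hx
    have hmem : i ∈ (x : Set ℕ) ↔ ν x = true := by
      rw [← hx, ← hteq x]
      simp [mixedSet, hi, hn x]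
    unfold signedSet
    split_ifs with hν
    · exact hmem.2 hν
    · exact fun h => hν (hmem.1 h)
  rw [Nat.frequently_atTop_iff_infinite] at hfreq
  exact Set.Infinite.of_image r hfreq

theorem not_isMeagerCollection_mixedSet (U : Ultrafilter ℕ) {r : ℕ → ℕ}
    (hr : ∀ n, {i | r i ≤ n}.Finite) (c : (ℕ → Bool × Bool) → Set ℕ) :
    ¬ IsMeagerCollection (mixedSet r c '' {t | ∀ᶠ n in U, (t n).2 = false}) := by
  classical
  intro hM
  obtain ⟨G, hGs, hGδ, hGd⟩ := mem_residual.1 hM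
  obtain ⟨V, hVo, rfl⟩ := isGδ_iff_eq_iInter_nat.1 hGδ
  obtain ⟨z, hz⟩ := exists_finite_modifications_mem (residual_of_dense_Gδ hGδ hGd)
  obtain ⟨B, hBU, hB⟩ := exists_not_mem_ultrafilter U
    (fun k a b => ∀ f : ℕ → Bool, (∀ i, a ≤ r i → r i < b → f i = z i) → f ∈ V k)
    (fun k a b b' hb h f hf => h f fun i h1 h2 => hf i h1 (h2.trans_le hb)) fun k a => by
      obtain ⟨Q, hQ⟩ := exists_finset_agree_mem (hVo k)
        (fun g hg => Set.mem_iInter.1 (hz g hg) k) (hr a).toFinset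
      refine ⟨Q.sup r + 1, fun f hf => hQ f fun i hi hia => hf i ?_ ?_⟩
      · simp only [Set.Finite.mem_toFinset, Set.mem_ofPred_eq, not_le] at hia
        exact hia.le
      · exact Nat.lt_succ_of_le (Finset.le_sup (f := r) hi)
  -- Copy `z` exactly on the levels in `B`; since `B` is omitted by `U`, this index is admissible.
  let t : ℕ → Bool × Bool := fun n => (z n, decide (n ∈ B))
  let f : ℕ → Bool := fun i => decide (i ∈ mixedSet r c t)
  have hfV : f ∈ ⋂ k, V k := Set.mem_iInter.2 fun k => by
    obtain ⟨a, b, hab, hsub⟩ := hB k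
    refine hab f fun i h1 h2 => ?_
    have : r i ∈ B := hsub ⟨h1, h2⟩
    simp [f, t, mixedSet, this]
  refine hGs hfV ⟨t, ?_, ?_⟩
  · filter_upwards [hBU] with n hn
    simpa [t] using hn
  · simp [f]

theorem theorem6p2 :
    ∃ A : Set (Set ℕ), IsIndependentFamily A ∧ ¬ IsMeagerCollection A := by
  obtain ⟨r, c, hr, hc⟩ := exists_rank_independent (Bool × Bool)
  exact ⟨_, isIndependentFamily_mixedSet (Nat.hyperfilter_le_atTop) hc,
    not_isMeagerCollection_mixedSet (hyperfilter ℕ) hr c⟩
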